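/- Let $K,N\ge 1$ be integers, $\sigma>0$, $p_1,\dots,p_K>0$ real and $\bar n_1,\dots,\bar n_K\ge 1$ integers, with the users numbered so that $p_1/\bar n_1\ge p_2/\bar n_2\ge\cdots\ge p_K/\bar n_K$. The maximum sum rate (in bits per chip) of the $K$-user multi-code CDMA system with processing gain $N$, noise variance $\sigma^2$ per dimension, powers $\underline p=(p_k)_k$ and upper limits $\underline{\bar n}=(\bar n_k)_k$ on the numbers of signature sequences of the users is $$\mathcal C_{\mathrm{CDMA}}(\underline p,\underline{\bar n},N,\sigma^2)=\max_{P,S}\ \frac1{2N}\log_2\det\Big(I_N+\frac1{\sigma^2}SPS^T\Big),$$ where the maximum is over all $P=\mathrm{diag}(P_1,\dots,P_K)$ with $P_k$ a real positive semidefinite $\bar n_k\times\bar n_k$ matrix and all $S=[S_1,\dots,S_K]$ with $S_k$ a real $N\times\bar n_k$ matrix such that $\frac1N\mathrm{tr}(S_kP_kS_k^T)=p_k$ for every $k$. User $k$ is called oversized if $$\Big(N-\sum_{j<k}\bar n_j\Big)\frac{p_k}{\sum_{j\ge k}p_j}>\bar n_k,$$ and $K_1$ denotes the number of oversized users. For total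 bandwidth $w$ and one-sided noise density $N_0$, the sum capacity of the multiple-access channel (MAC) is $\mathcal C_{\mathrm{MAC}}(\underline p,w,N_0)=w\log_2\big(1+\frac{\sum_k p_k}{N_0w}\big)$. Theorem. The maximum defining $\mathcal C_{\mathrm{CDMA}}$ is attained, and it is bounded by the sum capacity of the MAC: $$\mathcal C_{\mathrm{CDMA}}(\underline p,\underline{\bar n},N,\sigma^2)\le \mathcal C_{\mathrm{MAC}}\big(\underline p,\tfrac12,2\sigma^2\big)=\frac12\log_2\Big(1+\frac{\sum_{k=1}^Kp_k}{\sigma^2}\Big).$$ Equality holds if and only if there is no oversized user, i.e. $K_1=0$, or, equivalently, if and only if $$N\cdot\frac{p_1}{\sum_{k=1}^Kp_k}\le\bar n_1 .$$ -/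

import Mathlib

noncomputable section

/-- The full signature-sequence matrix `S = [S₁, …, S_K]`, obtained by placing the `N × n̄ₖ`
matrices `Sₖ` side by side. Its columns are indexed by the pairs (user, data stream). -/
def signatureMatrix {K N : ℕ} {n : Fin K → ℕ}
    (S : (k : Fin K) → Matrix (Fin N) (Fin (n k)) ℝ) :
    Matrix (Fin N) (Σ k : Fin K, Fin (n k)) ℝ :=
  Matrix.of fun i kl => S kl.1 i kl.2

/-- The sum rate, in bits per chip, of the multi-code CDMA system with data-correlation matrices
`Pₖ` and signature-sequence matrices `Sₖ`:
`(1 / (2 N)) log₂ det (I_N + (1 / σ²) S P Sᵀ)`, where `P = diag(P₁, …, P_K)`. -/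
def cdmaSumRate {K N : ℕ} {n : Fin K → ℕ} (σ : ℝ)
    (P : (k : Fin K) → Matrix (Fin (n k)) (Fin (n k)) ℝ)
    (S : (k : Fin K) → Matrix (Fin N) (Fin (n k)) ℝ) : ℝ :=
  1 / (2 * (N : ℝ)) * Real.logb 2
    (1 + (1 / σ ^ 2) •
      (signatureMatrix S * Matrix.blockDiagonal' P * (signatureMatrix S).transpose)).det

/-- Feasibility: every data-correlation matrix `Pₖ` is positive semidefinite, and user `k` has
average power `(1 / N) tr (Sₖ Pₖ Sₖᵀ) = pₖ`. -/
def CdmaFeasible {K N : ℕ} {n : Fin K → ℕ} (p : Fin K → ℝ)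
    (P : (k : Fin K) → Matrix (Fin (n k)) (Fin (n k)) ℝ)
    (S : (k : Fin K) → Matrix (Fin N) (Fin (n k)) ℝ) : Prop :=
  (∀ k, (P k).PosSemidef) ∧
    ∀ k, 1 / (N : ℝ) * (S k * P k * (S k).transpose).trace = p k

/-- The set of all sum rates of feasible multi-code CDMA systems with power profile `p`, upper
limits `n k` on the numbers of data streams, processing gain `N` and noise variance `σ²`. A user
with fewer than `n k` active streams is one some of whose data symbols have zero power. -/
def cdmaSumRates {K : ℕ} (p : Fin K → ℝ) (n : Fin K → ℕ) (N : ℕ) (σ : ℝ) : Set ℝ :=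
  {r | ∃ (P : (k : Fin K) → Matrix (Fin (n k)) (Fin (n k)) ℝ)
      (S : (k : Fin K) → Matrix (Fin N) (Fin (n k)) ℝ),
      CdmaFeasible p P S ∧ r = cdmaSumRate σ P S}

/-- The maximum sum rate `C_CDMA(p, n̄, N, σ²)` of the multi-code CDMA system. -/
def cdmaMaxSumRate {K : ℕ} (p : Fin K → ℝ) (n : Fin K → ℕ) (N : ℕ) (σ : ℝ) : ℝ :=
  sSup (cdmaSumRates p n N σ)

/-- The sum capacity `C_MAC(p, w, N₀) = w log₂ (1 + (∑ pₖ) / (N₀ w))` of the multiple-access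
channel with power profile `p`, total bandwidth `w` and one-sided noise density `N₀`. -/
def macSumCapacity {K : ℕ} (p : Fin K → ℝ) (w N₀ : ℝ) : ℝ :=
  w * Real.logb 2 (1 + (∑ k, p k) / (N₀ * w))

/-- The due share `n̂ₖ = (N - ∑_{j < k} n̄ⱼ) pₖ / ∑_{j ≥ k} pⱼ` of user `k`. -/
def dueShare {K : ℕ} (p : Fin K → ℝ) (n : Fin K → ℕ) (N : ℕ) (k : Fin K) : ℝ :=
  ((N : ℝ) - ∑ j ∈ Finset.Iio k, (n j : ℝ)) * (p k / ∑ j ∈ Finset.Ici k, p j)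

/-- User `k` is an oversized multi-code user if `n̂ₖ > n̄ₖ`. -/
def IsOversized {K : ℕ} (p : Fin K → ℝ) (n : Fin K → ℕ) (N : ℕ) (k : Fin K) : Prop :=
  (n k : ℝ) < dueShare p n N k

/-- The number `K₁` of oversized multi-code users. -/
def numOversized {K : ℕ} (p : Fin K → ℝ) (n : Fin K → ℕ) (N : ℕ) : ℕ :=
  Set.ncard {k : Fin K | IsOversized p n N k}

end

/-!
A positive semidefinite `Pₖ` factors as `B Bᵀ`, so with `Aₖ = Sₖ B` the only thing that matters about
a system is the family `A = (Aₖ)`, which ranges over a product of Frobenius spheres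
`‖Aₖ‖² = N pₖ` (`cdmaSumRates_eq_image`). This product is compact and nonempty and the rate is
continuous in `A`, so the maximum is attained.

All matrices `I + σ⁻² ∑ Aₖ Aₖᵀ` have the same trace. Applying `log x ≤ x - 1` to the normalized
eigenvalues bounds the determinant by that of the scalar matrix of this trace, which is the MAC
capacity, with equality exactly for *tight* families, those with `∑ Aₖ Aₖᵀ = (∑ pₖ) I`
(`gramRate_le_and_eq_iff`).

In a tight family no column has squared norm above `∑ pₖ`, so `N pₖ ≤ nₖ ∑ pⱼ` for every user
(`power_le_of_tight`). Conversely, if these inequalities hold, each user's power can be spread evenly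
over its `nₖ` columns, and a tight family with these column norms exists by the Schur–Horn theorem for
projections: there is a Parseval frame of `ℝᴺ` with prescribed squared norms `dᵢ`, provided
`0 ≤ dᵢ ≤ 1` and `∑ dᵢ = N` (`exists_parseval_of_norm_sq`). Because `pₖ / nₖ` is decreasing, the
inequality for the first user implies all the others, and is also equivalent to the absence of
oversized users (`forall_not_isOversized_iff`).
-/

/-! ### Parseval frames with prescribed norms -/

/-- A plane rotation of two vectors of a Parseval frame gives a Parseval frame. The frame property
`∑ uᵢ uᵢᵀ = I` is written out entrywise. -/
theorem givens_parseval {ι : Type*} [Fintype ι] [DecidableEq ι] {N : ℕ} {u : ι → Fin N → ℝ}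
    (hu : ∀ a b, ∑ i, u i a * u i b = (1 : Matrix (Fin N) (Fin N) ℝ) a b) {i j : ι} (hij : i ≠ j)
    {c s : ℝ} (hcs : c ^ 2 + s ^ 2 = 1) (a b : Fin N) :
    ∑ k, (Function.update (Function.update u i (c • u i + s • u j)) j
        (c • u j - s • u i)) k a *
      (Function.update (Function.update u i (c • u i + s • u j)) j (c • u j - s • u i)) k b =
      (1 : Matrix (Fin N) (Fin N) ℝ) a b := by
  have hj : j ∈ (Finset.univ.erase i : Finset ι) := by simp [hij.symm]
  rw [← hu a b, ← Finset.add_sum_erase _ _ (Finset.mem_univ i), ← Finset.add_sum_erase _ _ hj,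
    ← Finset.add_sum_erase _ (fun k => u k a * u k b) (Finset.mem_univ i),
    ← Finset.add_sum_erase _ (fun k => u k a * u k b) hj]
  have hrest : ∀ k ∈ (Finset.univ.erase i).erase j,
      Function.update (Function.update u i (c • u i + s • u j)) j (c • u j - s • u i) k = u k := by
    intro k hk
    simp only [Finset.mem_erase] at hk
    rw [Function.update_of_ne hk.1, Function.update_of_ne hk.2.1]
  rw [Finset.sum_congr rfl fun k hk => by rw [hrest k hk]]
  simp only [Function.update_self, Function.update_of_ne hij, Pi.add_apply, Pi.sub_apply,
    Pi.smul_apply, smul_eq_mul]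
  linear_combination (u i a * u i b + u j a * u j b) * hcs

/-- As a rotation swaps the roles of two vectors continuously, the squared norm of the first one
passes through every value between the two squared norms. -/
theorem exists_rotation_of_mem_Icc {N : ℕ} (x y : Fin N → ℝ) {t : ℝ}
    (hx : ∑ a, x a ^ 2 ≤ t) (hy : t ≤ ∑ a, y a ^ 2) :
    ∃ c s : ℝ, c ^ 2 + s ^ 2 = 1 ∧ ∑ a, (c • x + s • y) a ^ 2 = t := by
  have hcont : ContinuousOn
      (fun θ : ℝ => ∑ a, (Real.cos θ • x + Real.sin θ • y) a ^ 2) (Set.Icc 0 (Real.pi / 2)) := by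
    simp only [Pi.add_apply, Pi.smul_apply, smul_eq_mul]
    fun_prop
  obtain ⟨θ, -, hθ⟩ := intermediate_value_Icc (by positivity) hcont
    (show t ∈ Set.Icc _ _ by simpa using ⟨hx, hy⟩)
  exact ⟨Real.cos θ, Real.sin θ, by rw [add_comm, Real.sin_sq_add_cos_sq], hθ⟩

/-- When all prescribed squared norms are `0` or `1`, zero vectors and the standard basis form the
required Parseval frame. -/
theorem exists_parseval_of_zero_one {ι : Type*} [Fintype ι] [DecidableEq ι] {N : ℕ} {d : ι → ℝ}
    (h01 : ∀ i, d i = 0 ∨ d i = 1) (hsum : ∑ i, d i = N) :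
    ∃ u : ι → Fin N → ℝ,
      (∀ a b, ∑ i, u i a * u i b = (1 : Matrix (Fin N) (Fin N) ℝ) a b) ∧
      ∀ i, ∑ a, u i a ^ 2 = d i := by
  have hcard : Fintype.card {i // d i = 1} = N := by
    have h : ∑ i, d i = ∑ i, if d i = 1 then (1 : ℝ) else 0 :=
      Finset.sum_congr rfl fun i _ => by rcases h01 i with h | h <;> simp [h]
    rw [h, Finset.sum_boole] at hsum
    rw [Fintype.card_subtype]
    exact_mod_cast hsum
  let e : {i // d i = 1} ≃ Fin N := Fintype.equivFinOfCardEq hcard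
  have key : ∀ i a, (e.symm a : ι) = i ↔ ∃ h : d i = 1, e ⟨i, h⟩ = a := by
    intro i a
    constructor
    · rintro rfl
      exact ⟨(e.symm a).2, by simp⟩
    · rintro ⟨h, rfl⟩
      simp
  refine ⟨fun i a => if (e.symm a : ι) = i then 1 else 0, fun a b => ?_, fun i => ?_⟩
  · by_cases hab : a = b
    · subst hab
      simp
    · have : (e.symm a : ι) ≠ e.symm b := fun h => hab (e.symm.injective (Subtype.ext h))
      simp [Matrix.one_apply_ne hab, this]
  · rcases h01 i with h | h
    · have : ∀ a, (e.symm a : ι) ≠ i := fun a ha => by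
        have := (e.symm a).2
        rw [ha, h] at this
        exact zero_ne_one this
      simp [h, this]
    · simp [key, h]

/-- If one of the numbers of an integral sum is fractional, the others cannot all be `0` or `1`. -/
theorem exists_ne_of_fractional {ι : Type*} [Fintype ι] [DecidableEq ι] {N : ℕ} {d : ι → ℝ}
    (hsum : ∑ i, d i = N) {i : ι} (hi0 : 0 < d i) (hi1 : d i < 1) :
    ∃ j, j ≠ i ∧ d j ≠ 0 ∧ d j ≠ 1 := by
  by_contra! h
  have hz : ∑ j ∈ Finset.univ.erase i, d j =
      ((∑ j ∈ Finset.univ.erase i, if d j = 0 then (0 : ℤ) else 1 : ℤ) : ℝ) := by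
    push_cast
    refine Finset.sum_congr rfl fun j hj => ?_
    by_cases hj0 : d j = 0
    · simp [hj0]
    · simp [h j (Finset.ne_of_mem_erase hj) hj0]
  rw [← Finset.add_sum_erase _ _ (Finset.mem_univ i), hz] at hsum
  generalize (∑ j ∈ Finset.univ.erase i, if d j = 0 then (0 : ℤ) else 1 : ℤ) = z at hsum
  have h1 : ((z : ℤ) : ℝ) < ((N : ℤ) : ℝ) := by push_cast; linarith
  have h2 : ((N : ℤ) : ℝ) < ((z + 1 : ℤ) : ℝ) := by push_cast; linarith
  have h1' := Int.cast_lt.mp h1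
  have h2' := Int.cast_lt.mp h2
  omega

/-- The Schur–Horn theorem for projections, in the language of frames. The induction is on the number
of fractional `dᵢ`: two of them are pushed apart, keeping their sum, until one becomes `0` or `1`,
and a rotation of a frame with the new norms recovers the original ones. -/
theorem exists_parseval_of_norm_sq {ι : Type*} [Fintype ι] [DecidableEq ι] {N : ℕ} (d : ι → ℝ)
    (h0 : ∀ i, 0 ≤ d i) (h1 : ∀ i, d i ≤ 1) (hsum : ∑ i, d i = N) :
    ∃ u : ι → Fin N → ℝ,
      (∀ a b, ∑ i, u i a * u i b = (1 : Matrix (Fin N) (Fin N) ℝ) a b) ∧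
      ∀ i, ∑ a, u i a ^ 2 = d i := by
  induction hm : (Finset.univ.filter fun i => d i ≠ 0 ∧ d i ≠ 1).card using
    Nat.strong_induction_on generalizing d with
  | _ m ih =>
    subst hm
    by_cases hfrac : ∃ i, d i ≠ 0 ∧ d i ≠ 1
    swap
    · push Not at hfrac
      exact exists_parseval_of_zero_one (fun i => or_iff_not_imp_left.mpr (hfrac i)) hsum
    obtain ⟨i, j, hij, hi, hj, hle⟩ : ∃ i j, i ≠ j ∧ (d i ≠ 0 ∧ d i ≠ 1) ∧
        (d j ≠ 0 ∧ d j ≠ 1) ∧ d i ≤ d j := by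
      obtain ⟨i, hi⟩ := hfrac
      obtain ⟨j, hji, hj⟩ := exists_ne_of_fractional hsum (lt_of_le_of_ne (h0 i) hi.1.symm)
        (lt_of_le_of_ne (h1 i) hi.2)
      rcases le_total (d i) (d j) with h | h
      exacts [⟨i, j, hji.symm, hi, hj, h⟩, ⟨j, i, hji, hj, hi, h⟩]
    -- The largest spread that keeps both entries in `[0, 1]`; it makes one of them `0` or `1`.
    set t := min (d i) (1 - d j) with ht
    have ht0 : 0 ≤ t := le_min (h0 i) (by linarith [h1 j])
    have hti : t ≤ d i := min_le_left _ _
    have htj : t ≤ 1 - d j := min_le_right _ _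
    set d' : ι → ℝ := Function.update (Function.update d i (d i - t)) j (d j + t) with hd'
    have hd'j : d' j = d j + t := by simp [hd']
    have hd'i : d' i = d i - t := by simp [hd', hij]
    have hd'k : ∀ k, k ≠ i → k ≠ j → d' k = d k := fun k hki hkj => by simp [hd', hki, hkj]
    have hjmem : j ∈ (Finset.univ.erase i : Finset ι) := by simp [hij.symm]
    have split (f : ι → ℝ) : ∑ k, f k = f i + (f j + ∑ k ∈ (Finset.univ.erase i).erase j, f k) := by
      rw [← Finset.add_sum_erase _ _ (Finset.mem_univ i), ← Finset.add_sum_erase _ _ hjmem]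
    have hrange : ∀ k, 0 ≤ d' k ∧ d' k ≤ 1 := by
      intro k
      by_cases hki : k = i
      · subst hki
        exact ⟨by linarith, by linarith [h1 k]⟩
      by_cases hkj : k = j
      · subst hkj
        exact ⟨by linarith [h0 k], by linarith⟩
      rw [hd'k k hki hkj]
      exact ⟨h0 k, h1 k⟩
    have hsum' : ∑ k, d' k = N := by
      rw [← hsum, split d', split d, hd'i, hd'j,
        Finset.sum_congr rfl fun k hk => hd'k k
          (Finset.ne_of_mem_erase (Finset.mem_of_mem_erase hk)) (Finset.ne_of_mem_erase hk)]
      ring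
    have hlt : (Finset.univ.filter fun k => d' k ≠ 0 ∧ d' k ≠ 1).card <
        (Finset.univ.filter fun k => d k ≠ 0 ∧ d k ≠ 1).card := by
      refine Finset.card_lt_card ((Finset.ssubset_iff_of_subset fun k hk => ?_).mpr ?_)
      · by_cases hki : k = i
        · simpa [hki] using hi
        by_cases hkj : k = j
        · simpa [hkj] using hj
        simpa [hd'k k hki hkj] using hk
      · rcases min_choice (d i) (1 - d j) with h | h
        · exact ⟨i, by simpa using hi, by simp [hd'i, ht, h]⟩
        · exact ⟨j, by simpa using hj, by simp [hd'j, ht, h]⟩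
    obtain ⟨u, hu, hnorm⟩ := ih _ hlt d' (fun k => (hrange k).1) (fun k => (hrange k).2) hsum' rfl
    -- `d i ≤ d j` places `d i` between the two spread values `d i - t` and `d j + t`.
    obtain ⟨c, s, hcs, hrot⟩ := exists_rotation_of_mem_Icc (u i) (u j) (t := d i)
      (by rw [hnorm, hd'i]; linarith) (by rw [hnorm, hd'j]; linarith)
    refine ⟨_, givens_parseval hu hij hcs, fun k => ?_⟩
    by_cases hkj : k = j
    · subst hkj
      -- The rotation preserves the sum of the two squared norms, so the second is right as well.
      have h := Finset.sum_congr (rfl : (Finset.univ : Finset (Fin N)) = _) fun a _ =>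
        show (c • u k - s • u i) a ^ 2 = u k a ^ 2 + u i a ^ 2 - (c • u i + s • u k) a ^ 2 by
          simp only [Pi.add_apply, Pi.sub_apply, Pi.smul_apply, smul_eq_mul]
          linear_combination (u k a ^ 2 + u i a ^ 2) * hcs
      rw [Function.update_self, h, Finset.sum_sub_distrib, Finset.sum_add_distrib, hnorm, hnorm,
        hrot, hd'i, hd'j]
      ring
    · rw [Function.update_of_ne hkj]
      by_cases hki : k = i
      · subst hki
        rw [Function.update_self, hrot]
      · rw [Function.update_of_ne hki, hnorm, hd'k k hki hkj]

/-! ### The determinant at a given trace -/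

/-- The AM-GM inequality for the eigenvalues of a positive definite matrix, with its case of
equality. -/
theorem log_det_le_and_eq_iff {N : ℕ} {A : Matrix (Fin N) (Fin N) ℝ} (hA : A.PosDef) {μ : ℝ}
    (hμ : 0 < μ) (htr : A.trace = N * μ) :
    Real.log A.det ≤ N * Real.log μ ∧ (Real.log A.det = N * Real.log μ ↔ A = μ • 1) := by
  have hpos := hA.eigenvalues_pos
  have htr' : ∑ i, (hA.1.eigenvalues i / μ - 1) = 0 := by
    have h := hA.1.trace_eq_sum_eigenvalues
    simp only [RCLike.ofReal_real_eq_id, id] at h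
    rw [Finset.sum_sub_distrib, ← Finset.sum_div, ← h, htr]
    simp [hμ.ne']
  have hdet : Real.log A.det - N * Real.log μ = ∑ i, Real.log (hA.1.eigenvalues i / μ) := by
    rw [hA.1.det_eq_prod_eigenvalues]
    simp only [RCLike.ofReal_real_eq_id, id]
    rw [Real.log_prod fun i _ => (hpos i).ne',
      Finset.sum_congr rfl fun i _ => Real.log_div (hpos i).ne' hμ.ne']
    simp
  have hterm : ∀ i, Real.log (hA.1.eigenvalues i / μ) ≤ hA.1.eigenvalues i / μ - 1 :=
    fun i => Real.log_le_sub_one_of_pos (div_pos (hpos i) hμ)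
  have hle := Finset.sum_le_sum fun i (_ : i ∈ Finset.univ) => hterm i
  refine ⟨by linarith, fun heq => ?_, ?_⟩
  · have hall : ∀ i, hA.1.eigenvalues i = μ := by
      intro i
      have h := (Finset.sum_eq_sum_iff_of_le fun i (_ : i ∈ Finset.univ) => hterm i).mp
        (by linarith) i (Finset.mem_univ i)
      by_contra hne
      refine (Real.log_lt_sub_one_of_pos (div_pos (hpos i) hμ) fun h1 => hne ?_).ne h
      rwa [div_eq_one_iff_eq hμ.ne'] at h1
    have hdiag : Matrix.diagonal (RCLike.ofReal ∘ hA.1.eigenvalues) =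
        (μ • 1 : Matrix (Fin N) (Fin N) ℝ) := by
      rw [Matrix.smul_one_eq_diagonal]
      congr 1
      ext i
      simp [hall i]
    conv_lhs => rw [hA.1.spectral_theorem]
    rw [hdiag, map_smul, map_one]
  · rintro rfl
    simp [Real.log_pow]

/-! ### Reduction to a product of spheres -/

theorem signatureMatrix_mul_blockDiagonal {K N : ℕ} {n : Fin K → ℕ}
    (P : (k : Fin K) → Matrix (Fin (n k)) (Fin (n k)) ℝ)
    (S : (k : Fin K) → Matrix (Fin N) (Fin (n k)) ℝ) :
    signatureMatrix S * Matrix.blockDiagonal' P * (signatureMatrix S).transpose =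
      ∑ k, S k * P k * (S k).transpose := by
  ext a b
  simp only [signatureMatrix, Matrix.mul_apply, Matrix.sum_apply, Fintype.sum_sigma,
    Matrix.transpose_apply, Matrix.of_apply]
  refine Finset.sum_congr rfl fun k _ => Finset.sum_congr rfl fun l _ => ?_
  congr 1
  rw [Finset.sum_eq_single k]
  · simp
  · intro k' _ hk'
    simp [Matrix.blockDiagonal'_apply_ne _ _ _ hk']
  · simp

/-- The sum rate as a function of the matrices `Aₖ = Sₖ √Pₖ`, that is, of a system whose
data-correlation matrices are all equal to the identity. -/
noncomputable def gramRate {K N : ℕ} {n : Fin K → ℕ} (σ : ℝ)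
    (A : (k : Fin K) → Matrix (Fin N) (Fin (n k)) ℝ) : ℝ :=
  1 / (2 * (N : ℝ)) *
    Real.logb 2 (1 + (1 / σ ^ 2) • ∑ k, A k * (A k).transpose).det

/-- The families `(Aₖ)` that meet the power constraints `(1 / N) tr (Aₖ Aₖᵀ) = pₖ`; they form a product
of spheres for the Frobenius norm, written as sums of squares of the entries. -/
def powerSpheres {K : ℕ} (p : Fin K → ℝ) (n : Fin K → ℕ) (N : ℕ) :
    Set ((k : Fin K) → Matrix (Fin N) (Fin (n k)) ℝ) :=
  {A | ∀ k, ∑ i, ∑ j, A k i j ^ 2 = N * p k}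

theorem trace_mul_transpose_self {m n : Type*} [Fintype m] [Fintype n] (A : Matrix m n ℝ) :
    (A * A.transpose).trace = ∑ i, ∑ j, A i j ^ 2 := by
  simp [Matrix.trace, Matrix.mul_apply, sq]

open scoped MatrixOrder ComplexOrder in
theorem exists_eq_mul_transpose_of_posSemidef {m : Type*} [Fintype m] [DecidableEq m]
    {P : Matrix m m ℝ} (hP : P.PosSemidef) : ∃ B : Matrix m m ℝ, P = B * B.transpose := by
  obtain ⟨B, hB⟩ := CStarAlgebra.nonneg_iff_eq_mul_star_self.mp hP.nonneg
  exact ⟨B, by simpa [Matrix.star_eq_conjTranspose] using hB⟩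

theorem cdmaSumRates_eq_image {K : ℕ} (p : Fin K → ℝ) (n : Fin K → ℕ) {N : ℕ} (hN : 0 < N)
    (σ : ℝ) : cdmaSumRates p n N σ = gramRate σ '' powerSpheres p n N := by
  have hN' : (N : ℝ) ≠ 0 := by positivity
  have hpow (x y : ℝ) : 1 / (N : ℝ) * x = y ↔ x = N * y := by
    rw [one_div, inv_mul_eq_iff_eq_mul₀ hN']
  ext r
  constructor
  · rintro ⟨P, S, ⟨hP, hS⟩, rfl⟩
    choose B hB using fun k => exists_eq_mul_transpose_of_posSemidef (hP k)
    have hA : ∀ k, (S k * B k) * (S k * B k).transpose = S k * P k * (S k).transpose := fun k => by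
      rw [hB k, Matrix.transpose_mul]
      simp only [Matrix.mul_assoc]
    refine ⟨fun k => S k * B k, fun k => ?_, ?_⟩
    · rw [← trace_mul_transpose_self, hA, ← hpow]
      exact hS k
    · simp only [gramRate, cdmaSumRate, hA, signatureMatrix_mul_blockDiagonal]
  · rintro ⟨A, hA, rfl⟩
    refine ⟨fun _ => 1, A, ⟨fun _ => Matrix.PosSemidef.one, fun k => ?_⟩, ?_⟩
    · rw [hpow, Matrix.mul_one, trace_mul_transpose_self]
      exact hA k
    · simp only [gramRate, cdmaSumRate, signatureMatrix_mul_blockDiagonal, Matrix.mul_one]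

theorem isCompact_powerSpheres {K : ℕ} (p : Fin K → ℝ) (n : Fin K → ℕ) (N : ℕ) :
    IsCompact (powerSpheres p n N) := by
  have hbox : IsCompact (Set.univ.pi fun k : Fin K => Set.univ.pi fun _ : Fin N =>
      Set.univ.pi fun _ : Fin (n k) => Set.Icc (-√(N * p k)) (√(N * p k))) :=
    isCompact_univ_pi fun _ => isCompact_univ_pi fun _ => isCompact_univ_pi fun _ => isCompact_Icc
  refine hbox.of_isClosed_subset ?_ fun A hA k _ i _ j _ => ?_
  · simp only [powerSpheres, Set.ofPred_forall]
    exact isClosed_iInter fun k => isClosed_eq (by fun_prop) continuous_const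
  · rw [Set.mem_Icc, ← abs_le]
    refine Real.abs_le_sqrt ?_
    rw [← hA k]
    exact (Finset.single_le_sum (f := fun j => A k i j ^ 2) (fun _ _ => sq_nonneg _)
      (Finset.mem_univ j)).trans (Finset.single_le_sum (f := fun i => ∑ j, A k i j ^ 2)
        (fun _ _ => Finset.sum_nonneg fun _ _ => sq_nonneg _) (Finset.mem_univ i))

theorem nonempty_powerSpheres {K : ℕ} {p : Fin K → ℝ} (hp : ∀ k, 0 < p k) {n : Fin K → ℕ}
    (hn : ∀ k, 0 < n k) (N : ℕ) : (powerSpheres p n N).Nonempty := by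
  refine ⟨fun k => Matrix.of fun _ _ => √(p k / n k), fun k => ?_⟩
  have hnk : (0 : ℝ) < n k := by exact_mod_cast hn k
  have hpk := hp k
  simp only [Matrix.of_apply]
  rw [Real.sq_sqrt (by positivity)]
  simp only [Finset.sum_const, Finset.card_univ, Fintype.card_fin, nsmul_eq_mul]
  field_simp

theorem posDef_one_add_gram {K N : ℕ} {n : Fin K → ℕ} (σ : ℝ)
    (A : (k : Fin K) → Matrix (Fin N) (Fin (n k)) ℝ) :
    (1 + (1 / σ ^ 2) • ∑ k, A k * (A k).transpose).PosDef := by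
  refine Matrix.PosDef.one.add_posSemidef (Matrix.PosSemidef.smul ?_ (by positivity))
  exact Matrix.posSemidef_sum _ fun k _ => by
    simpa using Matrix.posSemidef_self_mul_conjTranspose (A k)

theorem continuous_gramRate {K N : ℕ} {n : Fin K → ℕ} (σ : ℝ) :
    Continuous (gramRate σ : ((k : Fin K) → Matrix (Fin N) (Fin (n k)) ℝ) → ℝ) := by
  unfold gramRate
  simp only [Real.logb]
  refine continuous_const.mul (Continuous.div_const (Continuous.log ?_ fun A =>
    (posDef_one_add_gram σ A).det_pos.ne') _)
  have hgram : Continuous fun A : (k : Fin K) → Matrix (Fin N) (Fin (n k)) ℝ =>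
      ∑ k, A k * (A k).transpose :=
    continuous_finsetSum _ fun k _ =>
      (continuous_apply k).matrix_mul (continuous_apply k).matrix_transpose
  exact (continuous_const.add (hgram.const_smul (1 / σ ^ 2))).matrix_det

/-! ### The capacity bound and tight families -/

/-- No feasible rate exceeds the MAC sum capacity, and it is reached exactly by the tight families. -/
theorem gramRate_le_and_eq_iff {K N : ℕ} (hN : 0 < N) {σ : ℝ} (hσ : 0 < σ) {p : Fin K → ℝ}
    (hp : ∀ k, 0 < p k) {n : Fin K → ℕ} {A : (k : Fin K) → Matrix (Fin N) (Fin (n k)) ℝ}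
    (hA : A ∈ powerSpheres p n N) :
    gramRate σ A ≤ 1 / 2 * Real.logb 2 (1 + (∑ k, p k) / σ ^ 2) ∧
    (gramRate σ A = 1 / 2 * Real.logb 2 (1 + (∑ k, p k) / σ ^ 2) ↔
      ∑ k, A k * (A k).transpose = (∑ k, p k) • 1) := by
  have hN' : (0 : ℝ) < N := by exact_mod_cast hN
  have hP : 0 ≤ ∑ k, p k := Finset.sum_nonneg fun k _ => (hp k).le
  have htr : (1 + (1 / σ ^ 2) • ∑ k, A k * (A k).transpose).trace =
      N * (1 + (∑ k, p k) / σ ^ 2) := by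
    rw [Matrix.trace_add, Matrix.trace_one, Matrix.trace_smul, Matrix.trace_sum,
      Finset.sum_congr rfl fun k _ => (trace_mul_transpose_self (A k)).trans (hA k),
      ← Finset.mul_sum]
    simp
    ring
  obtain ⟨h1, h2⟩ := log_det_le_and_eq_iff (posDef_one_add_gram σ A)
    (show 0 < 1 + (∑ k, p k) / σ ^ 2 by positivity) htr
  have hlog2 : 0 < Real.log 2 := Real.log_pos one_lt_two
  have hmac : 1 / 2 * Real.logb 2 (1 + (∑ k, p k) / σ ^ 2) =
      1 / (2 * N * Real.log 2) * (N * Real.log (1 + (∑ k, p k) / σ ^ 2)) := by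
    rw [Real.logb]; field_simp
  have hrate : gramRate σ A = 1 / (2 * N * Real.log 2) *
      Real.log (1 + (1 / σ ^ 2) • ∑ k, A k * (A k).transpose).det := by
    rw [gramRate, Real.logb]; field_simp
  have hc : 0 < 1 / (2 * N * Real.log 2) := by positivity
  rw [hmac, hrate]
  refine ⟨mul_le_mul_of_nonneg_left h1 hc.le, (mul_right_inj' hc.ne').trans (h2.trans ?_)⟩
  rw [add_smul, one_smul, add_right_inj, one_div, div_eq_inv_mul, mul_smul]
  exact smul_right_inj (inv_pos.mpr (by positivity)).ne'

/-- Column `x` of a tight family satisfies `‖x‖⁴ ≤ ∑ₐ ⟪x, a⟫² = c ‖x‖²`, the sum being over all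
columns `a`; hence `‖x‖² ≤ c`. User `k` has `n k` columns of total squared norm `N pₖ`. -/
theorem power_le_of_tight {K N : ℕ} {p : Fin K → ℝ} {n : Fin K → ℕ}
    {A : (k : Fin K) → Matrix (Fin N) (Fin (n k)) ℝ} (hA : A ∈ powerSpheres p n N) {c : ℝ}
    (hc : 0 ≤ c) (htight : ∑ k, A k * (A k).transpose = c • 1) (k : Fin K) :
    N * p k ≤ n k * c := by
  have hcol : ∀ j, ∑ i, A k i j ^ 2 ≤ c := by
    intro j
    set x : Fin N → ℝ := fun i => A k i j with hx
    have hquad : ∑ k', ∑ j', (∑ i, x i * A k' i j') ^ 2 = c * ∑ i, x i ^ 2 := by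
      have h := congrArg (fun M => dotProduct x (Matrix.mulVec M x)) htight
      simp only [Matrix.sum_mulVec, dotProduct_sum, Matrix.smul_mulVec, Matrix.one_mulVec,
        dotProduct_smul, smul_eq_mul, ← Matrix.mulVec_mulVec, Matrix.dotProduct_mulVec,
        Matrix.mulVec_transpose] at h
      simpa [dotProduct, Matrix.vecMul, sq] using h
    have hone : (∑ i, x i ^ 2) ^ 2 ≤ c * ∑ i, x i ^ 2 := by
      rw [← hquad]
      have h1 : (∑ i, x i ^ 2) ^ 2 = (∑ i, x i * A k i j) ^ 2 := by simp [hx, sq]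
      rw [h1]
      exact (Finset.single_le_sum (f := fun j' => (∑ i, x i * A k i j') ^ 2)
        (fun _ _ => sq_nonneg _) (Finset.mem_univ j)).trans
          (Finset.single_le_sum (f := fun k' => ∑ j', (∑ i, x i * A k' i j') ^ 2)
          (fun _ _ => Finset.sum_nonneg fun _ _ => sq_nonneg _) (Finset.mem_univ k))
    by_contra! h
    change c < ∑ i, x i ^ 2 at h
    nlinarith
  rw [← hA k, Finset.sum_comm]
  simpa using Finset.sum_le_sum fun j (_ : j ∈ Finset.univ) => hcol j

/-- A Parseval frame in which each of the `n k` vectors of user `k` has squared norm `N pₖ / (nₖ c)`,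
`c = ∑ pⱼ`, becomes after scaling by `√c` a tight family with the required powers. -/
theorem exists_tight_of_power_le {K N : ℕ} {p : Fin K → ℝ} (hp : ∀ k, 0 < p k)
    {n : Fin K → ℕ} (hn : ∀ k, 0 < n k) (hP : 0 < ∑ k, p k)
    (hle : ∀ k, N * p k ≤ n k * ∑ j, p j) :
    ∃ A ∈ powerSpheres p n N, ∑ k, A k * (A k).transpose = (∑ k, p k) • 1 := by
  set c := ∑ k, p k with hc
  have hn' : ∀ k, (0 : ℝ) < n k := fun k => by exact_mod_cast hn k
  have hsum : ∑ kj : (Σ k, Fin (n k)), N * p kj.1 / (n kj.1 * c) = N := by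
    rw [Fintype.sum_sigma]
    have h : ∀ k, ∑ _j : Fin (n k), N * p k / (n k * c) = N / c * p k := fun k => by
      have := (hn' k).ne'
      simp
      field_simp
    rw [Finset.sum_congr rfl fun k _ => h k, ← Finset.mul_sum, ← hc]
    field_simp
  obtain ⟨u, hu, hnorm⟩ := exists_parseval_of_norm_sq
    (fun kj : (Σ k, Fin (n k)) => N * p kj.1 / (n kj.1 * c))
    (fun kj => by have := hp kj.1; positivity)
    (fun kj => div_le_one_of_le₀ (hle kj.1) (by positivity)) hsum
  refine ⟨fun k => Matrix.of fun i j => √c * u ⟨k, j⟩ i, fun k => ?_, ?_⟩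
  · rw [Finset.sum_comm]
    simp only [Matrix.of_apply, mul_pow, Real.sq_sqrt hP.le, ← Finset.mul_sum, hnorm]
    have := (hn' k).ne'
    simp
    field_simp
  · ext a b
    rw [Matrix.smul_apply, ← hu a b, Fintype.sum_sigma]
    simp only [Matrix.sum_apply, Matrix.mul_apply, Matrix.transpose_apply, Matrix.of_apply,
      smul_eq_mul, Finset.mul_sum]
    refine Finset.sum_congr rfl fun k _ => Finset.sum_congr rfl fun j _ => ?_
    linear_combination (u ⟨k, j⟩ a * u ⟨k, j⟩ b) * Real.mul_self_sqrt hP.le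

/-! ### Oversized users -/

theorem forall_power_le_iff {K N : ℕ} (hK : 0 < K) {p : Fin K → ℝ} (hP : 0 < ∑ k, p k)
    {n : Fin K → ℕ} (hn : ∀ k, 0 < n k) (hord : Antitone fun k : Fin K => p k / (n k : ℝ)) :
    (∀ k, N * p k ≤ n k * ∑ j, p j) ↔
      (N : ℝ) * (p ⟨0, hK⟩ / ∑ k, p k) ≤ (n ⟨0, hK⟩ : ℝ) := by
  have hn' : ∀ k, (0 : ℝ) < n k := fun k => by exact_mod_cast hn k
  rw [← mul_div_assoc, div_le_iff₀ hP]
  refine ⟨fun h => h _, fun h k => ?_⟩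
  have h0 : p k / n k ≤ p ⟨0, hK⟩ / n ⟨0, hK⟩ := hord (Fin.mk_le_of_le_val (Nat.zero_le _))
  rw [mul_comm (n k : ℝ), ← div_le_iff₀ (hn' k), mul_div_assoc]
  refine (mul_le_mul_of_nonneg_left h0 (Nat.cast_nonneg N)).trans ?_
  rw [← mul_div_assoc, div_le_iff₀ (hn' _), mul_comm _ (n _ : ℝ)]
  exact h

theorem forall_not_isOversized_iff {K N : ℕ} (hK : 0 < K) {p : Fin K → ℝ} (hp : ∀ k, 0 < p k)
    {n : Fin K → ℕ} (hn : ∀ k, 0 < n k) (hord : Antitone fun k : Fin K => p k / (n k : ℝ)) :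
    (∀ k, ¬ IsOversized p n N k) ↔
      (N : ℝ) * (p ⟨0, hK⟩ / ∑ k, p k) ≤ (n ⟨0, hK⟩ : ℝ) := by
  have hn' : ∀ k, (0 : ℝ) < n k := fun k => by exact_mod_cast hn k
  have hle0 : ∀ k : Fin K, (⟨0, hK⟩ : Fin K) ≤ k := fun k => Fin.mk_le_of_le_val (Nat.zero_le _)
  have hP : 0 < ∑ k, p k := Finset.sum_pos (fun k _ => hp k) ⟨⟨0, hK⟩, Finset.mem_univ _⟩
  simp only [IsOversized, not_lt, dueShare]
  constructor
  · intro h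
    have h0 := h ⟨0, hK⟩
    have h1 : Finset.Iio (⟨0, hK⟩ : Fin K) = ∅ := by
      ext k; simp [hle0 k]
    have h2 : Finset.Ici (⟨0, hK⟩ : Fin K) = Finset.univ := by
      ext k; simp [hle0 k]
    simpa [h1, h2] using h0
  · intro h k
    -- `r` is the largest power per stream, so the users before `k` use at most `r ∑_{j < k} nⱼ`
    -- of the total power, which is at least `N r`.
    set r := p ⟨0, hK⟩ / n ⟨0, hK⟩ with hr
    have hNr : N * r ≤ ∑ k, p k := by
      rw [← mul_div_assoc, div_le_iff₀ hP] at h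
      rw [hr, ← mul_div_assoc, div_le_iff₀ (hn' _)]
      linarith
    have hpr : ∀ j, p j ≤ n j * r := fun j => by
      rw [mul_comm, ← div_le_iff₀ (hn' j)]
      exact hord (hle0 j)
    have htail : 0 < ∑ j ∈ Finset.Ici k, p j :=
      Finset.sum_pos (fun j _ => hp j) ⟨k, Finset.mem_Ici.mpr le_rfl⟩
    rw [← mul_div_assoc, div_le_iff₀ htail]
    have hsplit : ∑ j ∈ Finset.Iio k, p j + ∑ j ∈ Finset.Ici k, p j = ∑ j, p j := by
      have h1 : (Finset.Ici k : Finset (Fin K)) = (Finset.Iio k)ᶜ := by ext; simp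
      rw [h1, Finset.sum_add_sum_compl]
    have hhead : ∑ j ∈ Finset.Iio k, p j ≤ (∑ j ∈ Finset.Iio k, (n j : ℝ)) * r := by
      rw [Finset.sum_mul]
      exact Finset.sum_le_sum fun j _ => hpr j
    -- If the users before `k` exhaust the `N` dimensions, the due share of user `k` is not positive.
    rcases le_total ((N : ℝ) - ∑ j ∈ Finset.Iio k, (n j : ℝ)) 0 with hneg | hpos
    · exact (mul_nonpos_of_nonpos_of_nonneg hneg (hp k).le).trans
        (mul_nonneg (hn' k).le htail.le)
    · calc ((N : ℝ) - ∑ j ∈ Finset.Iio k, (n j : ℝ)) * p k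
          ≤ ((N : ℝ) - ∑ j ∈ Finset.Iio k, (n j : ℝ)) * (n k * r) :=
            mul_le_mul_of_nonneg_left (hpr k) hpos
        _ = n k * (N * r - (∑ j ∈ Finset.Iio k, (n j : ℝ)) * r) := by ring
        _ ≤ n k * ∑ j ∈ Finset.Ici k, p j :=
            mul_le_mul_of_nonneg_left (by linarith) (hn' k).le

theorem theorem2 (K N : ℕ) (hK : 0 < K) (hN : 0 < N) (σ : ℝ) (hσ : 0 < σ)
    (p : Fin K → ℝ) (hp : ∀ k, 0 < p k) (n : Fin K → ℕ) (hn : ∀ k, 0 < n k)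
    (hord : Antitone fun k : Fin K => p k / (n k : ℝ)) :
    IsGreatest (cdmaSumRates p n N σ) (cdmaMaxSumRate p n N σ) ∧
    macSumCapacity p (1 / 2) (2 * σ ^ 2)
      = 1 / 2 * Real.logb 2 (1 + (∑ k, p k) / σ ^ 2) ∧
    cdmaMaxSumRate p n N σ ≤ macSumCapacity p (1 / 2) (2 * σ ^ 2) ∧
    (cdmaMaxSumRate p n N σ = macSumCapacity p (1 / 2) (2 * σ ^ 2) ↔
      ∀ k, ¬ IsOversized p n N k) ∧
    (cdmaMaxSumRate p n N σ = macSumCapacity p (1 / 2) (2 * σ ^ 2) ↔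
      numOversized p n N = 0) ∧
    (cdmaMaxSumRate p n N σ = macSumCapacity p (1 / 2) (2 * σ ^ 2) ↔
      (N : ℝ) * (p ⟨0, hK⟩ / ∑ k, p k) ≤ (n ⟨0, hK⟩ : ℝ)) := by
  have hP : 0 < ∑ k, p k := Finset.sum_pos (fun k _ => hp k) ⟨⟨0, hK⟩, Finset.mem_univ _⟩
  have hmac : macSumCapacity p (1 / 2) (2 * σ ^ 2) =
      1 / 2 * Real.logb 2 (1 + (∑ k, p k) / σ ^ 2) := by
    rw [macSumCapacity, show 2 * σ ^ 2 * (1 / 2) = σ ^ 2 by ring]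
  have hgreat : IsGreatest (cdmaSumRates p n N σ) (cdmaMaxSumRate p n N σ) := by
    rw [cdmaMaxSumRate, cdmaSumRates_eq_image p n hN σ]
    exact ((isCompact_powerSpheres p n N).image (continuous_gramRate σ)).isGreatest_sSup
      ((nonempty_powerSpheres hp hn N).image _)
  obtain ⟨A, hA, hAmax⟩ : ∃ A ∈ powerSpheres p n N, gramRate σ A = cdmaMaxSumRate p n N σ := by
    have h := hgreat.1
    rwa [cdmaSumRates_eq_image p n hN σ] at h
  have hbound := gramRate_le_and_eq_iff hN hσ hp hA
  have hiff : cdmaMaxSumRate p n N σ = macSumCapacity p (1 / 2) (2 * σ ^ 2) ↔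
      (N : ℝ) * (p ⟨0, hK⟩ / ∑ k, p k) ≤ (n ⟨0, hK⟩ : ℝ) := by
    rw [← forall_power_le_iff hK hP hn hord, hmac]
    constructor
    · intro h
      exact power_le_of_tight hA hP.le (hbound.2.mp (hAmax.trans h))
    · intro h
      obtain ⟨B, hB, htight⟩ := exists_tight_of_power_le hp hn hP h
      refine le_antisymm (hAmax ▸ hbound.1) ?_
      rw [← (gramRate_le_and_eq_iff hN hσ hp hB).2.mpr htight]
      refine hgreat.2 ?_
      rw [cdmaSumRates_eq_image p n hN σ]
      exact ⟨B, hB, rfl⟩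
  have hover := hiff.trans (forall_not_isOversized_iff hK hp hn hord).symm
  refine ⟨hgreat, hmac, by rw [hmac, ← hAmax]; exact hbound.1, hover, hover.trans ?_, hiff⟩
  rw [numOversized, Set.ncard_eq_zero, Set.eq_empty_iff_forall_notMem]
  rfl
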